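/- Let $K$ be a field of characteristic different from $2$, let $d\ge 2$, and let $\mathbf P^d=\mathbf P(K^{d+1})$. **Confocal families.** A confocal family $\mathcal F$ of quadrics in $\mathbf P^d$ is given by a two-dimensional space $\mathcal D$ of symmetric $(d+1)\times(d+1)$ matrices (a pencil of dual quadrics) that contains an invertible matrix. A matrix $A\in\mathcal D$ of rank at least $d$ defines a quadric $\mathcal Q_A$ of the family: if $A$ is invertible, $\mathcal Q_A$ is the nondegenerate quadric $\{x : x^{T}A^{-1}x=0\}$, with the usual tangent hyperplanes; if $A$ has rank $d$ and kernel spanned by $h$, then $\mathcal Q_A$ is the doubled hyperplane $h^{T}x=0$, whose tangent hyperplane at each of its points is itself. A line $\ell$ touches a nonzero dual quadric $A\in\mathcal D$ if the restriction of the form $A$ to the covectors vanishing on $\ell$ is degenerate; for invertible $A$ this means that $\ell$ lies in the tangent hyperplane of $\mathcal Q_A$ at some point of $\ell$. **Reflection.** Let $x\in\mathcal Q_A$, let $u$ be the tangent hyperplane of $\mathcal Q_A$ at $x$, and let $z=A'u$ be the pole of $u$ with respect to another member $A'\in\mathcal D$, not proportional to $A$ (the line $xz$ does not depend on $A'$).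 Two lines $\ell_1,\ell_2$ that meet at $x$ obey the reflection law at $x$ if $\ell_1$, $\ell_2$, $xz$ and $\ell=\langle\ell_1,\ell_2\rangle\cap u$ are four coplanar lines through $x$ such that the pair $\ell_1,\ell_2$ is harmonically conjugate to the pair $xz,\ell$. In particular $\ell_1\neq\ell_2$. A sequence of lines $(a_t)_{t\in\mathbf Z}$ is a billiard trajectory within $\mathcal Q_A$ if, for every $t$, the lines $a_t,a_{t+1}$ obey the reflection law at a point $x_t$ of $\mathcal Q_A$, and $x_t\ne x_{t+1}$ unless $\mathcal Q_A$ is a doubled hyperplane. Lines $\ell,\ell_1,\ell_2,\ell_{12}$ form a double reflection configuration for quadrics $\mathcal Q,\mathcal Q'$ of $\mathcal F$ if there are points $x_1,x_2\in\mathcal Q$ and $y_1,y_2\in\mathcal Q'$ such that $(\ell,\ell_1)$, $(\ell_2,\ell_{12})$ obey the reflection law at $x_1$, $x_2$ of $\mathcal Q$, $(\ell,\ell_2)$, $(\ell_1,\ell_{12})$ obey it at $y_1$, $y_2$ of $\mathcal Q'$, and the four tangent hyperplanes to $\mathcal Q$ at $x_1,x_2$ and to $\mathcal Q'$ at $y_1,y_2$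 belong to a pencil. **Double reflection nets.** Fix $d-1$ nonzero members of $\mathcal D$ (repetitions allowed) and let $\mathcal A$ be the set of all lines that touch all of them. A double reflection net is a map $\varphi:\mathbf Z^m\to\mathcal A$ for which there are quadrics $\mathcal Q_1,\dots,\mathcal Q_m$ of $\mathcal F$ such that 1. for all $j$ and all $\mathbf n\in\mathbf Z^m$, the sequence $(\varphi(\mathbf n+t\mathbf e_j))_{t\in\mathbf Z}$ is a billiard trajectory within $\mathcal Q_j$; 2. for all $i\ne j$ and all $\mathbf n\in\mathbf Z^m$, the lines $\varphi(\mathbf n)$, $\varphi(\mathbf n+\mathbf e_i)$, $\varphi(\mathbf n+\mathbf e_j)$, $\varphi(\mathbf n+\mathbf e_i+\mathbf e_j)$ form a double reflection configuration for $\mathcal Q_i,\mathcal Q_j$. **Proposition.** Let $\varphi:\mathbf Z^m\to\mathcal A$ be a double reflection net, $\mathbf n_0\in\mathbf Z^m$, and let $i,j,k\in\{1,\dots,m\}$ be distinct. Then each of the intersections $$F_i=\varphi(\mathbf n_0)\cap\varphi(\mathbf n_0+\mathbf e_i),\qquad F_{ij}=\varphi(\mathbf n_0+\mathbf e_j)\cap\varphi(\mathbf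 n_0+\mathbf e_j+\mathbf e_i),$$ $$F_{ik}=\varphi(\mathbf n_0+\mathbf e_k)\cap\varphi(\mathbf n_0+\mathbf e_k+\mathbf e_i),\qquad F_{ijk}=\varphi(\mathbf n_0+\mathbf e_j+\mathbf e_k)\cap\varphi(\mathbf n_0+\mathbf e_j+\mathbf e_k+\mathbf e_i)$$ is a single point, and the four points $F_i,F_{ij},F_{ik},F_{ijk}$ are coplanar (they lie in a projective plane). -/

import Mathlib

open scoped LinearAlgebra.Projectivization

namespace DoubleReflection

/-- Lines of the projective space `P^d` over `K`: two-dimensional subspaces of `K^(d+1)`. -/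
def Line (K : Type*) [Field K] (d : ℕ) : Type _ :=
  {ℓ : Submodule K (Fin (d + 1) → K) // Module.finrank K ℓ = 2}

/-- The hyperplane `{v | u · v = 0}` with coordinate covector `u`. -/
def hyperplane {K : Type*} [Field K] {d : ℕ} (u : Fin (d + 1) → K) :
    Submodule K (Fin (d + 1) → K) where
  carrier := {v | u ⬝ᵥ v = 0}
  add_mem' := by
    intro a b ha hb
    change u ⬝ᵥ (a + b) = 0
    rw [dotProduct_add, show u ⬝ᵥ a = 0 from ha, show u ⬝ᵥ b = 0 from hb, add_zero]
  zero_mem' := by simp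
  smul_mem' := by
    intro c a ha
    change u ⬝ᵥ (c • a) = 0
    rw [dotProduct_smul, show u ⬝ᵥ a = 0 from ha, smul_zero]

/-- A confocal family of quadrics in `P^d`: a family whose projective dual is a pencil of quadrics.
It is given by its dual pencil, a two-dimensional space of symmetric matrices (quadratic forms on
covectors), at least one of which is nondegenerate. -/
structure ConfocalFamily (K : Type*) [Field K] (d : ℕ) where
  dualPencil : Submodule K (Matrix (Fin (d + 1)) (Fin (d + 1)) K)
  finrank_eq_two : Module.finrank K dualPencil = 2
  isSymm : ∀ A ∈ dualPencil, A.IsSymm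
  exists_det_ne_zero : ∃ A ∈ dualPencil, A.det ≠ 0

/-- The dual matrix `A` of the pencil defines a quadric `{x | x · adj(A) x = 0}` of the confocal
family. If `det A ≠ 0`, then `adj(A)` is proportional to `A⁻¹` and this is the nondegenerate quadric
dual to `A`. If `A` has corank one, with kernel spanned by `h`, then `adj(A)` is proportional to
`h hᵀ` and the quadric is the (doubled) hyperplane `h · x = 0`. If the corank is at least two, then
`adj(A) = 0` and there is no quadric. -/
def ConfocalFamily.HasQuadric {K : Type*} [Field K] {d : ℕ} (F : ConfocalFamily K d)
    (A : Matrix (Fin (d + 1)) (Fin (d + 1)) K) : Prop :=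
  A ∈ F.dualPencil ∧ A.adjugate ≠ 0

/-- `x` is a point of the quadric with dual matrix `A`, and `u` is (the covector of) the tangent
hyperplane at `x`. For `det A ≠ 0` this is the polar hyperplane of `x`; the tangent hyperplane of a
doubled hyperplane is that hyperplane itself. -/
def IsTangentAt {K : Type*} [Field K] {d : ℕ} (A : Matrix (Fin (d + 1)) (Fin (d + 1)) K)
    (x u : Fin (d + 1) → K) : Prop :=
  x ≠ 0 ∧ x ⬝ᵥ A.adjugate.mulVec x = 0 ∧ u ≠ 0 ∧
    ((A.det ≠ 0 ∧ ∃ c : K, u = c • A.adjugate.mulVec x) ∨ (A.det = 0 ∧ A.mulVec u = 0))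

/-- The line `ℓ` touches the quadric with dual matrix `A`: the restriction of `A` to the covectors
that vanish on `ℓ` is degenerate. For `det A ≠ 0` this says that `ℓ` lies in the tangent hyperplane
(with covector `ξ`) at one of its points (namely `A ξ`). -/
def IsTouchedBy {K : Type*} [Field K] {d : ℕ} (A : Matrix (Fin (d + 1)) (Fin (d + 1)) K)
    (ℓ : Line K d) : Prop :=
  ∃ ξ : Fin (d + 1) → K, ξ ≠ 0 ∧ ℓ.1 ≤ hyperplane ξ ∧ A.mulVec ξ ∈ ℓ.1

/-- `ℓ₁, ℓ₂, m₁, m₂` are four coplanar lines through a point `p`, and the pair `ℓ₁, ℓ₂` is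
harmonically conjugate to the pair `m₁, m₂` (cross-ratio `-1`). -/
def IsHarmonic {K : Type*} [Field K] {d : ℕ}
    (ℓ₁ ℓ₂ m₁ m₂ : Submodule K (Fin (d + 1) → K)) : Prop :=
  ∃ p a b : Fin (d + 1) → K, LinearIndependent K ![p, a, b] ∧
    ℓ₁ = Submodule.span K {p, a} ∧ ℓ₂ = Submodule.span K {p, b} ∧
    m₁ = Submodule.span K {p, a + b} ∧ m₂ = Submodule.span K {p, a - b}

/-- The lines `ℓ₁` and `ℓ₂` obey the reflection law at the point `x` of the quadric with dual
matrix `A`, where `u` is the tangent hyperplane at `x`, with respect to the confocal family `F`.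
Here `A' u` is the pole `z` of `u` with respect to another quadric of the family (with dual matrix
`A'`), the third line is `xz`, and the fourth one is the intersection of `u` with the plane of `ℓ₁`
and `ℓ₂`. The line `xz` does not depend on the choice of `A'`. -/
def ReflectionLaw {K : Type*} [Field K] {d : ℕ} (F : ConfocalFamily K d)
    (A : Matrix (Fin (d + 1)) (Fin (d + 1)) K) (ℓ₁ ℓ₂ : Line K d) (x u : Fin (d + 1) → K) : Prop :=
  IsTangentAt A x u ∧ x ∈ ℓ₁.1 ∧ x ∈ ℓ₂.1 ∧
    ∃ A' ∈ F.dualPencil, A' ∉ Submodule.span K {A} ∧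
      IsHarmonic ℓ₁.1 ℓ₂.1 (Submodule.span K {x, A'.mulVec u}) ((ℓ₁.1 ⊔ ℓ₂.1) ⊓ hyperplane u)

/-- The sequence `a` of lines is a billiard trajectory within the quadric with dual matrix `A`:
consecutive lines obey the reflection law at points `x i` of the quadric, and the successive
reflection points are different (unless the quadric is a doubled hyperplane, which a line
not contained in it meets only once). -/
def IsBilliardTrajectory {K : Type*} [Field K] {d : ℕ} (F : ConfocalFamily K d)
    (A : Matrix (Fin (d + 1)) (Fin (d + 1)) K) (a : ℤ → Line K d) : Prop :=
  ∃ x u : ℤ → Fin (d + 1) → K,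
    (∀ i, ReflectionLaw F A (a i) (a (i + 1)) (x i) (u i)) ∧
    (A.det ≠ 0 → ∀ i, LinearIndependent K ![x i, x (i + 1)])

/-- The lines `ℓ = x₁y₁`, `ℓ₁ = x₁y₂`, `ℓ₂ = x₂y₁`, `ℓ₁₂ = x₂y₂` form a double reflection
configuration, where `x₁, x₂` lie on the quadric with dual matrix `A₁` and have tangent hyperplanes
`α₁, α₂`, and `y₁, y₂` lie on the quadric with dual matrix `A₂` and have tangent hyperplanes
`β₁, β₂`: the four reflection laws hold, and the four tangent hyperplanes belong to a pencil. -/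
def IsDoubleReflectionConfiguration {K : Type*} [Field K] {d : ℕ} (F : ConfocalFamily K d)
    (A₁ A₂ : Matrix (Fin (d + 1)) (Fin (d + 1)) K) (ℓ ℓ₁ ℓ₂ ℓ₁₂ : Line K d) : Prop :=
  ∃ x₁ x₂ y₁ y₂ α₁ α₂ β₁ β₂ : Fin (d + 1) → K,
    ReflectionLaw F A₁ ℓ ℓ₁ x₁ α₁ ∧ ReflectionLaw F A₁ ℓ₂ ℓ₁₂ x₂ α₂ ∧
    ReflectionLaw F A₂ ℓ ℓ₂ y₁ β₁ ∧ ReflectionLaw F A₂ ℓ₁ ℓ₁₂ y₂ β₂ ∧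
    Module.finrank K (Submodule.span K {α₁, α₂, β₁, β₂}) ≤ 2

/-- The `i`-th unit vector of `ℤ^m`. -/
def e {m : ℕ} (i : Fin m) : Fin m → ℤ := Pi.single i 1

/-- `φ : ℤ^m → 𝒜` is a double reflection net of the confocal family `F`, where `𝒜` is the set of all
lines that touch `d - 1` fixed quadrics (caustics) of the family, multiple caustics being allowed. -/
def IsDoubleReflectionNet {K : Type*} [Field K] {d m : ℕ} (F : ConfocalFamily K d)
    (φ : (Fin m → ℤ) → Line K d) : Prop :=
  (∃ C : Fin (d - 1) → Matrix (Fin (d + 1)) (Fin (d + 1)) K,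
    (∀ s, C s ∈ F.dualPencil ∧ C s ≠ 0) ∧ ∀ n s, IsTouchedBy (C s) (φ n)) ∧
  ∃ Q : Fin m → Matrix (Fin (d + 1)) (Fin (d + 1)) K,
    (∀ j, F.HasQuadric (Q j)) ∧
    (∀ j n₀, IsBilliardTrajectory F (Q j) (fun t : ℤ => φ (n₀ + t • e j))) ∧
    (∀ i j, i ≠ j → ∀ n₀, IsDoubleReflectionConfiguration F (Q i) (Q j)
      (φ n₀) (φ (n₀ + e i)) (φ (n₀ + e j)) (φ (n₀ + e i + e j)))

/-- The point `p` is the value at `n` of the `i`-th focal net of `φ`: it is the intersection of the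
lines `φ(n)` and `φ(n + e_i)`. -/
def IsFocalPoint {K : Type*} [Field K] {d m : ℕ} (φ : (Fin m → ℤ) → Line K d)
    (i : Fin m) (n : Fin m → ℤ) (p : ℙ K (Fin (d + 1) → K)) : Prop :=
  p.submodule = (φ n).1 ⊓ (φ (n + e i)).1

/-- Four points of `P^d` are coplanar: they span a projective subspace of dimension at most two. -/
def Coplanar {K : Type*} [Field K] {d : ℕ} (p₁ p₂ p₃ p₄ : ℙ K (Fin (d + 1) → K)) : Prop :=
  Module.finrank K
    (p₁.submodule ⊔ p₂.submodule ⊔ p₃.submodule ⊔ p₄.submodule :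
      Submodule K (Fin (d + 1) → K)) ≤ 3

end DoubleReflection

namespace DoubleReflection

variable {K : Type*} [Field K] {d m : ℕ}

/-! Everything is carried by the tangent hyperplanes `U j n` at the reflection points `X j n`. By
`ReflectionLaw.eq_map`, a reflected line is the image of the incoming one under a linear map built
from the hyperplane `u` and its pole `B u`, for any member `B` of the pencil not proportional to
`A`, and `u · B u ≠ 0`. A tangent hyperplane of the quadric of `B` has `u · B u = 0`, so one line
can be reflected in one hyperplane by only one quadric, with one result (`ReflectionLaw.unique`).

If `Q i` is invertible, `X i n` is proportional to `Q i` applied to `U i n`, so it suffices that the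
four covectors on the edges of direction `i` span dimension at most three. Each face of the cube
puts its four covectors in a pencil. In general position the three covectors at the corner `n`
therefore generate those on all four edges (`finrank_le_three_of_cube`). When hyperplanes coincide,
either pencils merge (`finrank_le_three_of_shared`) or `ReflectionLaw.unique` applies.

If `Q i` is a doubled hyperplane, the four points lie in it and also on the four lines of a face,
which fit in a projective three-space (`exists_finrank_le_four`) not contained in the hyperplane. -/

@[simp]
theorem mem_hyperplane {u v : Fin (d + 1) → K} : v ∈ hyperplane u ↔ u ⬝ᵥ v = 0 := Iff.rfl

/-! ### Reflections in a hyperplane -/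

/-- A multiple of the reflection that negates `z` and fixes the hyperplane `u` pointwise. -/
def reflectionMap (u z : Fin (d + 1) → K) : (Fin (d + 1) → K) →ₗ[K] (Fin (d + 1) → K) where
  toFun v := (u ⬝ᵥ z) • v - (2 * (u ⬝ᵥ v)) • z
  map_add' v w := by rw [dotProduct_add]; module
  map_smul' c v := by simp only [dotProduct_smul, smul_eq_mul, RingHom.id_apply]; module

theorem reflectionMap_apply (u z v : Fin (d + 1) → K) :
    reflectionMap u z v = (u ⬝ᵥ z) • v - (2 * (u ⬝ᵥ v)) • z := rfl

theorem reflectionMap_reflectionMap (u z v : Fin (d + 1) → K) :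
    reflectionMap u z (reflectionMap u z v) = (u ⬝ᵥ z) ^ 2 • v := by
  rw [reflectionMap_apply, reflectionMap_apply, dotProduct_sub, dotProduct_smul, dotProduct_smul,
    smul_eq_mul, smul_eq_mul]
  module

theorem reflectionMap_injective {u z : Fin (d + 1) → K} (h : u ⬝ᵥ z ≠ 0) :
    Function.Injective (reflectionMap u z) := by
  refine (injective_iff_map_eq_zero _).2 fun v hv => ?_
  have h2 := reflectionMap_reflectionMap u z v
  rw [hv, map_zero] at h2
  exact (smul_eq_zero.1 h2.symm).resolve_left (pow_ne_zero 2 h)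

/-- A covector and its pole scale together, so images of lines depend only on the hyperplane. -/
theorem reflectionMap_smul_smul (c : K) (u z : Fin (d + 1) → K) :
    reflectionMap (c • u) (c • z) = c ^ 2 • reflectionMap u z := by
  refine LinearMap.ext fun v => ?_
  simp only [reflectionMap_apply, LinearMap.smul_apply, smul_dotProduct, dotProduct_smul,
    smul_eq_mul]
  module

/-! ### Tangent hyperplanes, poles and the dual pencil -/

/-- A matrix with nonzero adjugate has corank at most one. -/
theorem mem_span_of_mulVec_eq_zero {A : Matrix (Fin (d + 1)) (Fin (d + 1)) K}
    (hA : A.adjugate ≠ 0) {u w : Fin (d + 1) → K} (hu0 : u ≠ 0) (hu : A.mulVec u = 0)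
    (hw : A.mulVec w = 0) : w ∈ Submodule.span K {u} := by
  obtain ⟨i, j, hij⟩ : ∃ i j, A.adjugate i j ≠ 0 := by
    by_contra! h
    exact hA (Matrix.ext h)
  rw [Matrix.adjugate_apply] at hij
  -- Replacing row `j` by the `i`-th unit covector makes the matrix invertible, so a kernel vector
  -- is determined by its `i`-th coordinate.
  have key : ∀ v, A.mulVec v = 0 → v i = 0 → v = 0 := by
    intro v hv hvi
    refine Matrix.eq_zero_of_mulVec_eq_zero hij (funext fun k => ?_)
    by_cases hk : k = j
    · subst hk
      simp [Matrix.mulVec, hvi]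
    · simpa [Matrix.mulVec, Matrix.updateRow_ne hk] using congrFun hv k
  have hui : u i ≠ 0 := fun h => hu0 (key u hu h)
  have h := key (w - (w i / u i) • u)
    (by rw [Matrix.mulVec_sub, Matrix.mulVec_smul, hu, hw, smul_zero, sub_zero])
    (by simp [hui])
  exact Submodule.mem_span_singleton.2 ⟨w i / u i, (sub_eq_zero.1 h).symm⟩

theorem mem_span_symm {E : Type*} [AddCommGroup E] [Module K E] {v w : E}
    (hw : w ≠ 0) (h : w ∈ Submodule.span K {v}) : v ∈ Submodule.span K {w} := by
  obtain ⟨c, rfl⟩ := Submodule.mem_span_singleton.1 h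
  have hc : c ≠ 0 := fun h0 => hw (by rw [h0, zero_smul])
  exact Submodule.mem_span_singleton.2 ⟨c⁻¹, inv_smul_smul₀ hc v⟩

/-- The tangent hyperplane is determined by the point. -/
theorem IsTangentAt.mem_span {A : Matrix (Fin (d + 1)) (Fin (d + 1)) K} (hA : A.adjugate ≠ 0)
    {x u y w : Fin (d + 1) → K} (hu : IsTangentAt A x u) (hw : IsTangentAt A y w)
    (hyx : y ∈ Submodule.span K {x}) : w ∈ Submodule.span K {u} := by
  obtain ⟨-, -, hu0, hu⟩ := hu
  obtain ⟨-, -, -, hw⟩ := hw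
  obtain ⟨s, rfl⟩ := Submodule.mem_span_singleton.1 hyx
  rcases hu with ⟨hdet, c, rfl⟩ | ⟨hdet, hu⟩
  · rcases hw with ⟨-, c', rfl⟩ | ⟨h, -⟩
    · have hc : c ≠ 0 := fun h0 => hu0 (by rw [h0, zero_smul])
      refine Submodule.mem_span_singleton.2 ⟨c' * s * c⁻¹, ?_⟩
      rw [Matrix.mulVec_smul, smul_smul, smul_smul, inv_mul_cancel_right₀ hc]
    · exact absurd h hdet
  · rcases hw with ⟨h, -⟩ | ⟨-, hw⟩
    · exact absurd hdet h
    · exact mem_span_of_mulVec_eq_zero hA hu0 hu hw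

/-- The pole of a tangent hyperplane is its point of tangency. -/
theorem IsTangentAt.mulVec_mem_span {A : Matrix (Fin (d + 1)) (Fin (d + 1)) K}
    {x u : Fin (d + 1) → K} (h : IsTangentAt A x u) : A.mulVec u ∈ Submodule.span K {x} := by
  obtain ⟨-, -, -, ⟨-, c, rfl⟩ | ⟨-, hu⟩⟩ := h
  · refine Submodule.mem_span_singleton.2 ⟨c * A.det, ?_⟩
    rw [Matrix.mulVec_smul, Matrix.mulVec_mulVec, Matrix.mul_adjugate, Matrix.smul_mulVec,
      Matrix.one_mulVec, smul_smul]
  · rw [hu]; exact zero_mem _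

theorem IsTangentAt.mem_span_mulVec {A : Matrix (Fin (d + 1)) (Fin (d + 1)) K} (hA : A.det ≠ 0)
    {x u : Fin (d + 1) → K} (h : IsTangentAt A x u) : x ∈ Submodule.span K {A.mulVec u} :=
  mem_span_symm (fun h0 => h.2.2.1 (Matrix.eq_zero_of_mulVec_eq_zero hA h0)) h.mulVec_mem_span

/-- Two non-proportional members span the dual pencil. -/
theorem ConfocalFamily.exists_combination (F : ConfocalFamily K d)
    {A B C : Matrix (Fin (d + 1)) (Fin (d + 1)) K} (hA : A ∈ F.dualPencil) (hA0 : A ≠ 0)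
    (hB : B ∈ F.dualPencil) (hBA : B ∉ Submodule.span K {A}) (hC : C ∈ F.dualPencil) :
    ∃ s t : K, C = s • A + t • B := by
  have hli : LinearIndependent K ![A, B] :=
    (LinearIndependent.pair_iff' hA0).2 fun a h => hBA (Submodule.mem_span_singleton.2 ⟨a, h⟩)
  have h2 : Module.finrank K (Submodule.span K {A, B}) = 2 := by
    have := finrank_span_eq_card hli
    rwa [Matrix.range_cons_cons_empty, Fintype.card_fin] at this
  have hle : Submodule.span K {A, B} ≤ F.dualPencil := by
    rw [Submodule.span_le, Set.insert_subset_iff, Set.singleton_subset_iff]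
    exact ⟨hA, hB⟩
  have heq := Submodule.eq_of_le_of_finrank_eq hle (h2.trans F.finrank_eq_two.symm)
  rw [← heq, Submodule.mem_span_pair] at hC
  obtain ⟨s, t, h⟩ := hC
  exact ⟨s, t, h.symm⟩

theorem ConfocalFamily.HasQuadric.ne_zero {F : ConfocalFamily K d} (hd : 2 ≤ d)
    {A : Matrix (Fin (d + 1)) (Fin (d + 1)) K} (h : F.HasQuadric A) : A ≠ 0 := by
  rintro rfl
  have : Nontrivial (Fin (d + 1)) := Fin.nontrivial_iff_two_le.2 (by omega)
  exact h.2 Matrix.adjugate_zero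

/-! ### The reflection law as a linear map -/

theorem linearIndependent_triple {E : Type*} [AddCommGroup E] [Module K E] {p a b : E} :
    LinearIndependent K ![p, a, b] ↔
      ∀ r s t : K, r • p + s • a + t • b = 0 → r = 0 ∧ s = 0 ∧ t = 0 := by
  rw [Fintype.linearIndependent_iff]
  constructor
  · intro h r s t h0
    have := h ![r, s, t] (by simpa [Fin.sum_univ_three] using h0)
    exact ⟨this 0, this 1, this 2⟩
  · intro h g hg
    rw [Fin.sum_univ_three] at hg
    obtain ⟨h0, h1, h2⟩ := h _ _ _ hg
    intro i
    fin_cases i <;> assumption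

theorem IsHarmonic.symm {ℓ₁ ℓ₂ m₁ m₂ : Submodule K (Fin (d + 1) → K)}
    (h : IsHarmonic ℓ₁ ℓ₂ m₁ m₂) : IsHarmonic ℓ₂ ℓ₁ m₁ m₂ := by
  obtain ⟨p, a, b, hli, h1, h2, h3, h4⟩ := h
  refine ⟨p, b, a, ?_, h2, h1, by rw [h3, add_comm a b], ?_⟩
  · rw [linearIndependent_triple] at hli ⊢
    intro r s t h0
    obtain ⟨hr, ht, hs⟩ := hli r t s (by rw [← h0]; abel)
    exact ⟨hr, hs, ht⟩
  · rw [h4, ← neg_sub b a, Submodule.span_insert, Submodule.span_insert, ← Set.neg_singleton,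
      Submodule.span_neg]

theorem ReflectionLaw.symm {F : ConfocalFamily K d} {A : Matrix (Fin (d + 1)) (Fin (d + 1)) K}
    {ℓ₁ ℓ₂ : Line K d} {x u : Fin (d + 1) → K} (h : ReflectionLaw F A ℓ₁ ℓ₂ x u) :
    ReflectionLaw F A ℓ₂ ℓ₁ x u := by
  obtain ⟨h1, h2, h3, A', hA', hA, h4⟩ := h
  exact ⟨h1, h3, h2, A', hA', hA, by rw [sup_comm]; exact h4.symm⟩

/-- The coordinates in which a reflection law holds. -/
theorem ReflectionLaw.exists_frame {F : ConfocalFamily K d}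
    {A : Matrix (Fin (d + 1)) (Fin (d + 1)) K} {ℓ₁ ℓ₂ : Line K d} {x u : Fin (d + 1) → K}
    (h : ReflectionLaw F A ℓ₁ ℓ₂ x u) :
    ∃ a b : Fin (d + 1) → K, LinearIndependent K ![x, a, b] ∧
      ℓ₁.1 = Submodule.span K {x, a} ∧ ℓ₂.1 = Submodule.span K {x, b} ∧
      u ⬝ᵥ x = 0 ∧ u ⬝ᵥ a ≠ 0 ∧ u ⬝ᵥ b = u ⬝ᵥ a ∧
      ∃ A' ∈ F.dualPencil, A' ∉ Submodule.span K {A} ∧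
        ∃ s t : K, a + b = s • x + t • A'.mulVec u := by
  obtain ⟨hT, hx1, hx2, A', hA', hA, p, a, b, hli, h1, h2, h3, h4⟩ := h
  have hli' := linearIndependent_triple.1 hli
  obtain ⟨c, hc⟩ : ∃ c : K, x = c • p := by
    rw [h1, Submodule.mem_span_pair] at hx1
    rw [h2, Submodule.mem_span_pair] at hx2
    obtain ⟨s, t, hst⟩ := hx1
    obtain ⟨s', t', hst'⟩ := hx2
    have := hli' (s - s') t (-t') (by linear_combination (norm := module) hst - hst')
    exact ⟨s, by rw [← hst, this.2.1, zero_smul, add_zero]⟩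
  have hc0 : c ≠ 0 := fun h0 => hT.1 (by rw [hc, h0, zero_smul])
  have hspan : ∀ v, Submodule.span K {x, v} = Submodule.span K {p, v} := by
    intro v
    rw [hc, Submodule.span_insert, Submodule.span_insert,
      Submodule.span_singleton_smul_eq (IsUnit.mk0 c hc0)]
  have hp : u ⬝ᵥ p = 0 := by
    have : p ∈ (ℓ₁.1 ⊔ ℓ₂.1) ⊓ hyperplane u := by
      rw [h4]; exact Submodule.subset_span (by simp)
    exact this.2
  have hab : u ⬝ᵥ b = u ⬝ᵥ a := by
    have : a - b ∈ (ℓ₁.1 ⊔ ℓ₂.1) ⊓ hyperplane u := by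
      rw [h4]; exact Submodule.subset_span (by simp)
    have h := this.2
    rw [SetLike.mem_coe, mem_hyperplane, dotProduct_sub, sub_eq_zero] at h
    exact h.symm
  -- Otherwise `a` would lie on the fourth harmonic line, the span of `p` and `a - b`.
  have ha : u ⬝ᵥ a ≠ 0 := by
    intro h0
    have : a ∈ (ℓ₁.1 ⊔ ℓ₂.1) ⊓ hyperplane u :=
      ⟨Submodule.mem_sup_left (by rw [h1]; exact Submodule.subset_span (by simp)), h0⟩
    rw [h4, Submodule.mem_span_pair] at this
    obtain ⟨s, t, hst⟩ := this
    have := hli' s (t - 1) (-t) (by linear_combination (norm := module) hst)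
    have ht : t = 0 := neg_eq_zero.1 this.2.2
    simp [ht] at this
  refine ⟨a, b, ?_, by rw [hspan, h1], by rw [hspan, h2], ?_, ha, hab, A', hA', hA, ?_⟩
  · rw [linearIndependent_triple]
    intro r s t h0
    rw [hc, smul_smul] at h0
    obtain ⟨h5, h6⟩ := hli' _ _ _ h0
    exact ⟨(mul_eq_zero.1 h5).resolve_right hc0, h6⟩
  · rw [hc, dotProduct_smul, hp, smul_zero]
  · have : a + b ∈ Submodule.span K {x, A'.mulVec u} := by
      rw [h3]; exact Submodule.subset_span (by simp)
    obtain ⟨s, t, h⟩ := Submodule.mem_span_pair.1 this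
    exact ⟨s, t, h.symm⟩

section

variable {F : ConfocalFamily K d} {A B : Matrix (Fin (d + 1)) (Fin (d + 1)) K}
  {ℓ₁ ℓ₂ ℓ₃ : Line K d} {x u y w : Fin (d + 1) → K}

theorem ReflectionLaw.dotProduct_eq_zero (h : ReflectionLaw F A ℓ₁ ℓ₂ x u) : u ⬝ᵥ x = 0 := by
  obtain ⟨a, b, -, -, -, h, -⟩ := h.exists_frame
  exact h

theorem ReflectionLaw.not_le (h : ReflectionLaw F A ℓ₁ ℓ₂ x u) : ¬ ℓ₁.1 ≤ hyperplane u := by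
  obtain ⟨a, b, -, h1, -, -, ha, -⟩ := h.exists_frame
  intro hle
  exact ha (hle (by rw [h1]; exact Submodule.subset_span (by simp)))

/-- The reflection point depends only on the two lines, so points obtained from different witnesses
of the law can be compared. -/
theorem ReflectionLaw.inf_eq (h : ReflectionLaw F A ℓ₁ ℓ₂ x u) :
    ℓ₁.1 ⊓ ℓ₂.1 = Submodule.span K {x} := by
  refine le_antisymm ?_ ((Submodule.span_singleton_le_iff_mem _ _).2 ⟨h.2.1, h.2.2.1⟩)
  obtain ⟨a, b, hli, h1, h2, -⟩ := h.exists_frame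
  rintro v ⟨hv1, hv2⟩
  rw [SetLike.mem_coe, h1, Submodule.mem_span_pair] at hv1
  rw [SetLike.mem_coe, h2, Submodule.mem_span_pair] at hv2
  obtain ⟨s, t, hst⟩ := hv1
  obtain ⟨s', t', hst'⟩ := hv2
  have := linearIndependent_triple.1 hli (s - s') t (-t')
    (by linear_combination (norm := module) hst - hst')
  exact Submodule.mem_span_singleton.2 ⟨s, by rw [← hst, this.2.1, zero_smul, add_zero]⟩

/-- Reflected lines are images under the reflection that is determined by the tangent hyperplane
and its pole with respect to any other member of the family. -/
theorem ReflectionLaw.eq_map (hK : (2 : K) ≠ 0) (hA : A ∈ F.dualPencil) (hA0 : A ≠ 0)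
    (h : ReflectionLaw F A ℓ₁ ℓ₂ x u) (hB : B ∈ F.dualPencil) (hBA : B ∉ Submodule.span K {A}) :
    u ⬝ᵥ B.mulVec u ≠ 0 ∧ ℓ₂.1 = ℓ₁.1.map (reflectionMap u (B.mulVec u)) := by
  obtain ⟨a, b, hli, h1, h2, hx, ha, hab, A', hA', hA'A, s, t, hst⟩ := h.exists_frame
  obtain ⟨s₁, t₁, rfl⟩ := F.exists_combination hA hA0 hB hBA hA'
  obtain ⟨c, hc⟩ := Submodule.mem_span_singleton.1 h.1.mulVec_mem_span
  set z := B.mulVec u with hz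
  -- The `A`-component of `A'` contributes only a multiple of `x`, since `A u` is a multiple of `x`;
  -- hence `A'` may be traded for `B`.
  have hab2 : a + b = (s + t * s₁ * c) • x + (t * t₁) • z := by
    rw [hst, Matrix.add_mulVec, Matrix.smul_mulVec, Matrix.smul_mulVec, ← hc, ← hz]
    module
  have huz : 2 * (u ⬝ᵥ a) = t * t₁ * (u ⬝ᵥ z) := by
    have := congrArg (u ⬝ᵥ ·) hab2
    simp only [dotProduct_add, dotProduct_smul, hx, hab, smul_eq_mul] at this
    linear_combination this
  have hz0 : u ⬝ᵥ z ≠ 0 := by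
    intro h0
    rw [h0, mul_zero] at huz
    exact mul_ne_zero hK ha huz
  refine ⟨hz0, (Submodule.eq_of_le_of_finrank_eq ?_ ?_).symm⟩
  · rw [h1, h2, Submodule.map_span_le]
    rintro v (rfl | rfl)
    · rw [reflectionMap_apply, hx, mul_zero, zero_smul, sub_zero]
      exact Submodule.smul_mem _ _ (Submodule.subset_span (by simp))
    -- By `huz` the image of `a` is `(u · z) (a - t t₁ z)`, and `hab2` turns the bracket into a
    -- multiple of `x` minus `b`.
    · refine Submodule.mem_span_pair.2 ⟨(u ⬝ᵥ z) * (s + t * s₁ * c), -(u ⬝ᵥ z), ?_⟩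
      rw [reflectionMap_apply, huz]
      linear_combination (norm := module) (-(u ⬝ᵥ z)) • hab2
  · exact (Submodule.equivMapOfInjective _ (reflectionMap_injective hz0) _).finrank_eq.symm.trans
      (ℓ₁.2.trans ℓ₂.2.symm)

/-- If a line is reflected at two quadrics of the family in the same hyperplane, then the quadrics
and the reflected lines are the same. -/
theorem ReflectionLaw.unique (hK : (2 : K) ≠ 0) (hA : A ∈ F.dualPencil) (hA0 : A ≠ 0)
    (hB : B ∈ F.dualPencil) (hB0 : B ≠ 0)
    (h : ReflectionLaw F A ℓ₁ ℓ₂ x u) (h' : ReflectionLaw F B ℓ₁ ℓ₃ y w)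
    (hwu : w ∈ Submodule.span K {u}) : B ∈ Submodule.span K {A} ∧ ℓ₂ = ℓ₃ := by
  obtain ⟨c, rfl⟩ := Submodule.mem_span_singleton.1 hwu
  have hc : c ≠ 0 := fun h0 => h'.1.2.2.1 (by rw [h0, zero_smul])
  -- The pole of `w` with respect to `B` is its point of tangency, which lies on `w`; this
  -- contradicts `u · B u ≠ 0`.
  have hAB : B ∈ Submodule.span K {A} := by
    by_contra hBA
    apply (h.eq_map hK hA hA0 hB hBA).1
    obtain ⟨r, hr⟩ := Submodule.mem_span_singleton.1 h'.1.mulVec_mem_span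
    have h0 : (c • u) ⬝ᵥ B.mulVec (c • u) = 0 := by
      rw [← hr, dotProduct_smul, h'.dotProduct_eq_zero, smul_zero]
    rw [Matrix.mulVec_smul, smul_dotProduct, dotProduct_smul] at h0
    simpa [hc] using h0
  refine ⟨hAB, ?_⟩
  obtain ⟨-, -, -, C, hC, hCA, -⟩ := id h
  have hCB : C ∉ Submodule.span K {B} := fun hCB =>
    hCA ((Submodule.span_singleton_le_iff_mem _ _).2 hAB hCB)
  have e1 := (h.eq_map hK hA hA0 hC hCA).2
  have e2 := (h'.eq_map hK hB hB0 hC hCB).2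
  rw [Matrix.mulVec_smul, reflectionMap_smul_smul, Submodule.map_smul _ _ _ (pow_ne_zero 2 hc)]
    at e2
  exact Subtype.ext (e1.trans e2.symm)

end

/-! ### Dimension counts -/

section LinearAlgebra

variable {E : Type*} [AddCommGroup E] [Module K E]

theorem le_span_pair [FiniteDimensional K E] {S : Submodule K E} (hS : Module.finrank K S ≤ 2)
    {a b : E} (ha : a ∈ S) (hb : b ∈ S) (ha0 : a ≠ 0) (hba : b ∉ Submodule.span K {a}) :
    S ≤ Submodule.span K {a, b} := by
  have hli : LinearIndependent K ![a, b] :=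
    (LinearIndependent.pair_iff' ha0).2 fun c h => hba (Submodule.mem_span_singleton.2 ⟨c, h⟩)
  have h2 : Module.finrank K (Submodule.span K {a, b}) = 2 := by
    have := finrank_span_eq_card hli
    rwa [Matrix.range_cons_cons_empty, Fintype.card_fin] at this
  have hle : Submodule.span K {a, b} ≤ S := by
    rw [Submodule.span_le, Set.insert_subset_iff, Set.singleton_subset_iff]
    exact ⟨ha, hb⟩
  exact (Submodule.eq_of_le_of_finrank_le hle (by omega)).ge

theorem finrank_sup_le_of_mem [FiniteDimensional K E] {S T : Submodule K E} {n : ℕ}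
    (hT : Module.finrank K T ≤ n + 1) {x : E} (hx : x ≠ 0) (hxS : x ∈ S) (hxT : x ∈ T) :
    Module.finrank K (S ⊔ T : Submodule K E) ≤ Module.finrank K S + n := by
  have h := Submodule.finrank_sup_add_finrank_inf_eq S T
  have h1 : 1 ≤ Module.finrank K (S ⊓ T : Submodule K E) :=
    Submodule.one_le_finrank_iff.2 fun h0 => hx ((Submodule.mem_bot K).1 (h0 ▸ ⟨hxS, hxT⟩))
  omega

theorem finrank_sup_span_singleton_le [FiniteDimensional K E] (S : Submodule K E) (v : E) :
    Module.finrank K (S ⊔ Submodule.span K {v} : Submodule K E) ≤ Module.finrank K S + 1 :=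
  (Submodule.finrank_add_le_finrank_add_finrank _ _).trans
    (Nat.add_le_add_left ((finrank_span_le_card {v}).trans (by simp)) _)

end LinearAlgebra

/-! ### The lines of a double reflection configuration -/

section

variable {F : ConfocalFamily K d} {A B : Matrix (Fin (d + 1)) (Fin (d + 1)) K}

/-- The four lines of a double reflection configuration lie in a three-dimensional projective
subspace. -/
theorem exists_finrank_le_four (hK : (2 : K) ≠ 0) (hd : 2 ≤ d) (hA : F.HasQuadric A)
    {ℓ ℓ₁ ℓ₂ ℓ₃ : Line K d} {x₁ x₂ y₁ y₂ α₁ α₂ β₁ β₂ : Fin (d + 1) → K}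
    (h₁ : ReflectionLaw F A ℓ ℓ₁ x₁ α₁) (h₂ : ReflectionLaw F A ℓ₂ ℓ₃ x₂ α₂)
    (h₃ : ReflectionLaw F B ℓ ℓ₂ y₁ β₁) (h₄ : ReflectionLaw F B ℓ₁ ℓ₃ y₂ β₂) :
    ∃ W : Submodule K (Fin (d + 1) → K), Module.finrank K W ≤ 4 ∧
      ℓ.1 ≤ W ∧ ℓ₁.1 ≤ W ∧ ℓ₂.1 ≤ W ∧ ℓ₃.1 ≤ W := by
  have hℓ : Module.finrank K (ℓ.1 ⊔ ℓ₂.1 : Submodule K (Fin (d + 1) → K)) ≤ 3 :=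
    (finrank_sup_le_of_mem (n := 1) ℓ₂.2.le h₃.1.1 h₃.2.1 h₃.2.2.1).trans
      (Nat.add_le_add_right ℓ.2.le 1)
  set U := ℓ.1 ⊔ ℓ₂.1 ⊔ ℓ₁.1 with hU
  have hU4 : Module.finrank K U ≤ 4 :=
    (finrank_sup_le_of_mem (n := 1) ℓ₁.2.le h₁.1.1 (Submodule.mem_sup_left h₁.2.1)
      h₁.2.2.1).trans (Nat.add_le_add_right hℓ 1)
  have i0 : ℓ.1 ≤ U := le_sup_left.trans le_sup_left
  have i2 : ℓ₂.1 ≤ U := le_sup_right.trans le_sup_left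
  have i1 : ℓ₁.1 ≤ U := le_sup_right
  -- If `x₂` and `y₂` are different points, they span `ℓ₃` inside `U`. Otherwise `ℓ₁`, `ℓ₂`, `ℓ₃`
  -- all pass through `x₂`.
  by_cases hy : y₂ ∈ Submodule.span K {x₂}
  swap
  · refine ⟨U, hU4, i0, i1, i2, (le_span_pair ℓ₃.2.le h₂.2.2.1 h₄.2.2.1 h₂.1.1 hy).trans ?_⟩
    rw [Submodule.span_le, Set.insert_subset_iff, Set.singleton_subset_iff]
    exact ⟨i2 h₂.2.1, i1 h₄.2.1⟩
  have hx₂ : x₂ ∈ ℓ₁.1 :=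
    (Submodule.span_singleton_le_iff_mem _ _).2 h₄.2.1 (mem_span_symm h₄.1.1 hy)
  by_cases hU3 : Module.finrank K U ≤ 3
  · exact ⟨U ⊔ ℓ₃.1, (finrank_sup_le_of_mem (n := 1) ℓ₃.2.le h₂.1.1 (i1 hx₂) h₂.2.2.1).trans
      (Nat.add_le_add_right hU3 1), i0.trans le_sup_left, i1.trans le_sup_left,
      i2.trans le_sup_left, le_sup_right⟩
  -- If `x₁` and `x₂` were different, they would span `ℓ₁` inside the plane of `ℓ` and `ℓ₂`, and `U`
  -- would have dimension at most three.
  have hx : x₂ ∈ Submodule.span K {x₁} := by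
    by_contra hx
    have hle : ℓ₁.1 ≤ ℓ.1 ⊔ ℓ₂.1 := by
      refine (le_span_pair ℓ₁.2.le h₁.2.2.1 hx₂ h₁.1.1 hx).trans ?_
      rw [Submodule.span_le, Set.insert_subset_iff, Set.singleton_subset_iff]
      exact ⟨Submodule.mem_sup_left h₁.2.1, Submodule.mem_sup_right h₂.2.1⟩
    rw [hU, sup_eq_left.2 hle] at hU3
    exact hU3 hℓ
  refine ⟨U, hU4, i0, i1, i2, ?_⟩
  obtain ⟨c, rfl⟩ := Submodule.mem_span_singleton.1 (h₁.1.mem_span hA.2 h₂.1 hx)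
  have hc : c ≠ 0 := fun h0 => h₂.1.2.2.1 (by rw [h0, zero_smul])
  obtain ⟨-, -, -, C, hC, hCA, -⟩ := id h₁
  have e₁ := (h₁.eq_map hK hA.1 (hA.ne_zero hd) hC hCA).2
  have e₂ := (h₂.eq_map hK hA.1 (hA.ne_zero hd) hC hCA).2
  rw [Matrix.mulVec_smul, reflectionMap_smul_smul, Submodule.map_smul _ _ _ (pow_ne_zero 2 hc)]
    at e₂
  -- Both reflections at `x₁` are now the same up to scale. It carries a vector of `ℓ` outside the
  -- hyperplane into `ℓ₁`, so the pole lies in `U` and the reflection preserves `U`.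
  have hz : C.mulVec α₁ ∈ U := by
    obtain ⟨v, hv, hv0⟩ := SetLike.not_le_iff_exists.1 h₁.not_le
    have hmem : reflectionMap α₁ (C.mulVec α₁) v ∈ U :=
      i1 (e₁ ▸ Submodule.mem_map_of_mem hv)
    rw [reflectionMap_apply] at hmem
    exact (Submodule.smul_mem_iff _ (mul_ne_zero hK hv0)).1
      ((Submodule.sub_mem_iff_right _ (Submodule.smul_mem _ _ (i0 hv))).1 hmem)
  rw [e₂, Submodule.map_le_iff_le_comap]
  intro v hv
  rw [Submodule.mem_comap, reflectionMap_apply]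
  exact sub_mem (Submodule.smul_mem _ _ (i2 hv)) (Submodule.smul_mem _ _ hz)

end

/-! ### Covectors on the edges of a cube -/

/-- Four covectors are linearly dependent if they lie in two pencils with a common member. -/
theorem finrank_le_three_of_shared {a b c aj ak ajk cj : Fin (d + 1) → K}
    {S₁ S₂ S₃ : Submodule K (Fin (d + 1) → K)} (h₁ : Module.finrank K S₁ ≤ 2)
    (h₂ : Module.finrank K S₂ ≤ 2) (h₃ : Module.finrank K S₃ ≤ 2)
    (ha : a ≠ 0) (hb : b ≠ 0) (hcj : cj ≠ 0)
    (hba : b ∈ Submodule.span K {a}) (hca : c ∉ Submodule.span K {a})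
    (m₁ : a ∈ S₁ ∧ ak ∈ S₁ ∧ c ∈ S₁) (m₂ : b ∈ S₂ ∧ c ∈ S₂ ∧ cj ∈ S₂)
    (m₃ : aj ∈ S₃ ∧ ajk ∈ S₃ ∧ cj ∈ S₃) :
    ∃ S : Submodule K (Fin (d + 1) → K),
      Module.finrank K S ≤ 3 ∧ a ∈ S ∧ aj ∈ S ∧ ak ∈ S ∧ ajk ∈ S := by
  have haS : a ∈ S₂ := (Submodule.span_singleton_le_iff_mem _ _).2 m₂.1 (mem_span_symm hb hba)
  -- The merged pencils put `cj` in `S₁`, so `S₁` and `S₃` share a nonzero vector.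
  have hle : S₂ ≤ S₁ := (le_span_pair h₂ haS m₂.2.1 ha hca).trans <| by
    rw [Submodule.span_le, Set.insert_subset_iff, Set.singleton_subset_iff]
    exact ⟨m₁.1, m₁.2.2⟩
  refine ⟨S₁ ⊔ S₃, (finrank_sup_le_of_mem (n := 1) h₃ hcj (hle m₂.2.2) m₃.2.2).trans
    (Nat.add_le_add_right h₁ 1), ?_⟩
  exact ⟨Submodule.mem_sup_left m₁.1, Submodule.mem_sup_right m₃.1,
    Submodule.mem_sup_left m₁.2.1, Submodule.mem_sup_right m₃.2.1⟩

/-- If the covectors on the faces of a cube lie in pencils, then those on four parallel edges span a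
space of dimension at most three. -/
theorem finrank_le_three_of_cube {a b c aj ak ajk bk : Fin (d + 1) → K}
    {S₁ S₂ S₃ S₄ : Submodule K (Fin (d + 1) → K)} (h₁ : Module.finrank K S₁ ≤ 2)
    (h₂ : Module.finrank K S₂ ≤ 2) (h₃ : Module.finrank K S₃ ≤ 2) (h₄ : Module.finrank K S₄ ≤ 2)
    (ha : a ≠ 0) (hb : b ≠ 0) (hak : ak ≠ 0) (hbk : bk ≠ 0)
    (hba : b ∉ Submodule.span K {a}) (hca : c ∉ Submodule.span K {a})
    (hcb : c ∉ Submodule.span K {b})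
    (m₁ : a ∈ S₁ ∧ aj ∈ S₁ ∧ b ∈ S₁) (m₂ : a ∈ S₂ ∧ ak ∈ S₂ ∧ c ∈ S₂)
    (m₃ : b ∈ S₃ ∧ bk ∈ S₃ ∧ c ∈ S₃) (m₄ : ak ∈ S₄ ∧ ajk ∈ S₄ ∧ bk ∈ S₄)
    (hdep : ak ∈ Submodule.span K {c} → bk ∈ Submodule.span K {c} →
      Module.finrank K (Submodule.span K (Set.range ![a, b, c])) ≤ 2) :
    ∃ S : Submodule K (Fin (d + 1) → K),
      Module.finrank K S ≤ 3 ∧ a ∈ S ∧ aj ∈ S ∧ ak ∈ S ∧ ajk ∈ S := by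
  set S := Submodule.span K (Set.range ![a, b, c]) with hS
  have iab : Submodule.span K {a, b} ≤ S := Submodule.span_mono (by
    rintro v (rfl | rfl); exacts [⟨0, rfl⟩, ⟨1, rfl⟩])
  have iac : Submodule.span K {a, c} ≤ S := Submodule.span_mono (by
    rintro v (rfl | rfl); exacts [⟨0, rfl⟩, ⟨2, rfl⟩])
  have ibc : Submodule.span K {b, c} ≤ S := Submodule.span_mono (by
    rintro v (rfl | rfl); exacts [⟨1, rfl⟩, ⟨2, rfl⟩])
  have haj := le_span_pair h₁ m₁.1 m₁.2.2 ha hba m₁.2.1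
  have hak' := le_span_pair h₂ m₂.1 m₂.2.2 ha hca m₂.2.1
  have hbk' := le_span_pair h₃ m₃.1 m₃.2.2 hb hcb m₃.2.1
  have haS : a ∈ S := Submodule.subset_span ⟨0, rfl⟩
  have hsmall : Module.finrank K S ≤ 2 → ∃ S : Submodule K (Fin (d + 1) → K),
      Module.finrank K S ≤ 3 ∧ a ∈ S ∧ aj ∈ S ∧ ak ∈ S ∧ ajk ∈ S := fun h =>
    ⟨S ⊔ Submodule.span K {ajk},
      (finrank_sup_span_singleton_le S ajk).trans (Nat.add_le_add_right h 1),
      Submodule.mem_sup_left haS, Submodule.mem_sup_left (iab haj),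
      Submodule.mem_sup_left (iac hak'),
      Submodule.mem_sup_right (Submodule.mem_span_singleton_self ajk)⟩
  by_cases hli : LinearIndependent K ![a, b, c]
  swap
  · rw [linearIndependent_iff_card_le_finrank_span, Fintype.card_fin, not_le] at hli
    exact hsmall (Nat.le_of_lt_succ hli)
  -- If `ak` and `bk` are proportional, they lie in both `⟨a, c⟩` and `⟨b, c⟩`, which meet only in
  -- `⟨c⟩`; this is the case that `hdep` handles.
  by_cases hp : bk ∈ Submodule.span K {ak}
  · obtain ⟨r, hr⟩ := Submodule.mem_span_singleton.1 hp
    obtain ⟨s, t, hst⟩ := Submodule.mem_span_pair.1 hak'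
    obtain ⟨s', t', hst'⟩ := Submodule.mem_span_pair.1 hbk'
    obtain ⟨hrs, hs', -⟩ := linearIndependent_triple.1 hli (-(r * s)) s' (t' - r * t)
      (by linear_combination (norm := module) hst' - hr - r • hst)
    have hr0 : r ≠ 0 := fun h0 => hbk (by rw [← hr, h0, zero_smul])
    have hs : s = 0 := (mul_eq_zero.1 (neg_eq_zero.1 hrs)).resolve_left hr0
    refine hsmall (hdep ?_ ?_)
    · exact Submodule.mem_span_singleton.2 ⟨t, by rw [← hst, hs, zero_smul, zero_add]⟩
    · exact Submodule.mem_span_singleton.2 ⟨t', by rw [← hst', hs', zero_smul, zero_add]⟩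
  · refine ⟨S, (finrank_range_le_card ![a, b, c]).trans (by simp), haS, iab haj, iac hak', ?_⟩
    refine (le_span_pair h₄ m₄.1 m₄.2.2 hak hp).trans ?_ m₄.2.1
    rw [Submodule.span_le, Set.insert_subset_iff, Set.singleton_subset_iff]
    exact ⟨iac hak', ibc hbk'⟩

/-! ### Coplanarity of the reflection points -/

theorem exists_mk_coplanar {x₁ x₂ x₃ x₄ : Fin (d + 1) → K} (h₁ : x₁ ≠ 0) (h₂ : x₂ ≠ 0)
    (h₃ : x₃ ≠ 0) (h₄ : x₄ ≠ 0) {T : Submodule K (Fin (d + 1) → K)} (hT : Module.finrank K T ≤ 3)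
    (m₁ : x₁ ∈ T) (m₂ : x₂ ∈ T) (m₃ : x₃ ∈ T) (m₄ : x₄ ∈ T) :
    Coplanar (Projectivization.mk K x₁ h₁) (Projectivization.mk K x₂ h₂)
      (Projectivization.mk K x₃ h₃) (Projectivization.mk K x₄ h₄) := by
  refine (Submodule.finrank_mono ?_).trans hT
  simp only [Projectivization.submodule_mk, sup_le_iff, Submodule.span_singleton_le_iff_mem]
  exact ⟨⟨⟨m₁, m₂⟩, m₃⟩, m₄⟩

/-- The reflection points on four parallel edges of a cube in a double reflection net are
coplanar. -/
theorem exists_finrank_le_three (hK : (2 : K) ≠ 0) (hd : 2 ≤ d)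
    {F : ConfocalFamily K d} {φ : (Fin m → ℤ) → Line K d}
    {Q : Fin m → Matrix (Fin (d + 1)) (Fin (d + 1)) K} (hQ : ∀ j, F.HasQuadric (Q j))
    {X U : Fin m → (Fin m → ℤ) → Fin (d + 1) → K}
    (hR : ∀ j n, ReflectionLaw F (Q j) (φ n) (φ (n + e j)) (X j n) (U j n))
    (hP : ∀ i j, i ≠ j → ∀ n, ∃ S : Submodule K (Fin (d + 1) → K), Module.finrank K S ≤ 2 ∧
      U i n ∈ S ∧ U i (n + e j) ∈ S ∧ U j n ∈ S ∧ U j (n + e i) ∈ S)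
    (n : Fin m → ℤ) {i j k : Fin m} (hij : i ≠ j) (hik : i ≠ k) (hjk : j ≠ k) :
    ∃ T : Submodule K (Fin (d + 1) → K), Module.finrank K T ≤ 3 ∧
      X i n ∈ T ∧ X i (n + e j) ∈ T ∧ X i (n + e k) ∈ T ∧ X i (n + e j + e k) ∈ T := by
  have hQ0 : ∀ j, Q j ≠ 0 := fun j => (hQ j).ne_zero hd
  have hU0 : ∀ j n, U j n ≠ 0 := fun j n => (hR j n).1.2.2.1
  have hX : ∀ j n, X j n ∈ (φ n).1 := fun j n => (hR j n).2.1
  by_cases hdet : (Q i).det = 0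
  · obtain ⟨W, hW4, i0, i1, i2, i3⟩ := exists_finrank_le_four hK hd (hQ j) (hR j n)
      (by simpa only [add_right_comm] using hR j (n + e k)) (hR k n) (hR k (n + e j))
    have hker : ∀ n, (Q i).mulVec (U i n) = 0 := fun n =>
      ((hR i n).1.2.2.2.resolve_left fun h => h.1 hdet).2
    -- The kernel of `Q i` is one-dimensional, so all the tangent covectors `U i` define the same
    -- hyperplane.
    have hperp : ∀ n', X i n' ∈ hyperplane (U i n) := by
      intro n'
      obtain ⟨c, hc⟩ := Submodule.mem_span_singleton.1
        (mem_span_of_mulVec_eq_zero (hQ i).2 (hU0 i n') (hker n') (hker n))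
      rw [mem_hyperplane, ← hc, smul_dotProduct, (hR i n').dotProduct_eq_zero, smul_zero]
    refine ⟨W ⊓ hyperplane (U i n), ?_, ⟨i0 (hX _ _), hperp _⟩, ⟨i1 (hX _ _), hperp _⟩,
      ⟨i2 (hX _ _), hperp _⟩, ⟨i3 (hX _ _), hperp _⟩⟩
    have hlt : W ⊓ hyperplane (U i n) < W :=
      inf_le_left.lt_of_ne fun h => (hR i n).not_le (i0.trans (inf_eq_left.1 h))
    have := Submodule.finrank_lt_finrank_of_lt hlt
    omega
  suffices h : U j n ∈ Submodule.span K {U i n} ∧ U k n ∈ Submodule.span K {U i n} ∨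
      ∃ S : Submodule K (Fin (d + 1) → K), Module.finrank K S ≤ 3 ∧
      U i n ∈ S ∧ U i (n + e j) ∈ S ∧ U i (n + e k) ∈ S ∧ U i (n + e j + e k) ∈ S by
    rcases h with ⟨hj, hk⟩ | ⟨S, hS, m0, m1, m2, m3⟩
    -- All three reflections of `φ n` use one hyperplane, so the three neighbouring lines coincide
    -- and contain three of the four points.
    · have ej := ((hR i n).unique hK (hQ i).1 (hQ0 i) (hQ j).1 (hQ0 j) (hR j n) hj).2
      have ek := ((hR i n).unique hK (hQ i).1 (hQ0 i) (hQ k).1 (hQ0 k) (hR k n) hk).2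
      refine ⟨(φ (n + e i)).1 ⊔ Submodule.span K {X i (n + e j + e k)},
        (finrank_sup_span_singleton_le _ _).trans (Nat.add_le_add_right (φ _).2.le 1),
        Submodule.mem_sup_left (hR i n).2.2.1, Submodule.mem_sup_left ?_,
        Submodule.mem_sup_left ?_, Submodule.mem_sup_right (Submodule.mem_span_singleton_self _)⟩
      · rw [ej]; exact hX _ _
      · rw [ek]; exact hX _ _
    · have key : ∀ n', U i n' ∈ S → X i n' ∈ S.map (Q i).mulVecLin := fun n' h =>
        (Submodule.span_singleton_le_iff_mem _ _).2 (Submodule.mem_map_of_mem h)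
          ((hR i n').1.mem_span_mulVec hdet)
      exact ⟨S.map (Q i).mulVecLin, (Submodule.finrank_map_le _ _).trans hS,
        key _ m0, key _ m1, key _ m2, key _ m3⟩
  have hcomm : n + e k + e j = n + e j + e k := add_right_comm _ _ _
  obtain ⟨Sij, dij, ij1, ij2, ij3, ij4⟩ := hP i j hij n
  obtain ⟨Sik, dik, ik1, ik2, ik3, ik4⟩ := hP i k hik n
  obtain ⟨Sjk, djk, jk1, jk2, jk3, jk4⟩ := hP j k hjk n
  obtain ⟨Tij, eij, tij1, tij2, tij3, -⟩ := hP i j hij (n + e k)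
  obtain ⟨Tik, eik, tik1, tik2, tik3, -⟩ := hP i k hik (n + e j)
  rw [hcomm] at tij2
  by_cases hba : U j n ∈ Submodule.span K {U i n}
  · by_cases hca : U k n ∈ Submodule.span K {U i n}
    · exact Or.inl ⟨hba, hca⟩
    · exact Or.inr (finrank_le_three_of_shared dik djk eik (hU0 _ _) (hU0 _ _) (hU0 _ _) hba hca
        ⟨ik1, ik2, ik3⟩ ⟨jk1, jk3, jk4⟩ ⟨tik1, tik2, tik3⟩)
  refine Or.inr ?_
  by_cases hca : U k n ∈ Submodule.span K {U i n}
  · obtain ⟨S, hS, m0, m1, m2, m3⟩ :=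
      finrank_le_three_of_shared dij djk eij (hU0 _ _) (hU0 _ _) (hU0 _ _) hca hba
        ⟨ij1, ij2, ij3⟩ ⟨jk3, jk1, jk2⟩ ⟨tij1, tij2, tij3⟩
    exact ⟨S, hS, m0, m2, m1, m3⟩
  by_cases hcb : U k n ∈ Submodule.span K {U j n}
  -- Three of the four covectors lie in one pencil, and the fourth adds at most one dimension.
  · have hle : Sij ≤ Sik := (le_span_pair dij ij1 ij3 (hU0 _ _) hba).trans <| by
      rw [Submodule.span_le, Set.insert_subset_iff, Set.singleton_subset_iff]
      exact ⟨ik1, (Submodule.span_singleton_le_iff_mem _ _).2 ik3 (mem_span_symm (hU0 _ _) hcb)⟩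
    exact ⟨Sik ⊔ Submodule.span K {U i (n + e j + e k)},
      (finrank_sup_span_singleton_le _ _).trans (Nat.add_le_add_right dik 1),
      Submodule.mem_sup_left ik1, Submodule.mem_sup_left (hle ij2), Submodule.mem_sup_left ik2,
      Submodule.mem_sup_right (Submodule.mem_span_singleton_self _)⟩
  refine finrank_le_three_of_cube dij dik djk eij (hU0 _ _) (hU0 _ _) (hU0 _ _) (hU0 _ _)
    hba hca hcb ⟨ij1, ij2, ij3⟩ ⟨ik1, ik2, ik3⟩ ⟨jk1, jk2, jk3⟩ ⟨tij1, tij2, tij3⟩ ?_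
  -- The line `φ (n + e k)` is reflected in the hyperplane `U k n` by `Q k`, back to `φ n`, and also
  -- by `Q i` and `Q j`, so the three matrices are proportional. The injective map `Q i` then sends
  -- all three covectors at `n` to vectors of the two-dimensional `φ n`.
  intro hak hbk
  have hki : Q i ∈ Submodule.span K {Q k} :=
    ((hR k n).symm.unique hK (hQ k).1 (hQ0 k) (hQ i).1 (hQ0 i) (hR i (n + e k)) hak).1
  have hkj : Q j ∈ Submodule.span K {Q k} :=
    ((hR k n).symm.unique hK (hQ k).1 (hQ0 k) (hQ j).1 (hQ0 j) (hR j (n + e k)) hbk).1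
  have hall : ∀ l, Q i ∈ Submodule.span K {Q l} → (Q i).mulVec (U l n) ∈ (φ n).1 := by
    intro l hl
    obtain ⟨c, hc⟩ := Submodule.mem_span_singleton.1 hl
    rw [← hc, Matrix.smul_mulVec]
    exact Submodule.smul_mem _ _ ((Submodule.span_singleton_le_iff_mem _ _).2 (hX l n)
      (hR l n).1.mulVec_mem_span)
  have hji : Q i ∈ Submodule.span K {Q j} :=
    (Submodule.span_singleton_le_iff_mem _ _).2 (mem_span_symm (hQ0 j) hkj) hki
  have hinj : Function.Injective (Q i).mulVecLin :=
    (injective_iff_map_eq_zero _).2 fun v hv => Matrix.eq_zero_of_mulVec_eq_zero hdet hv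
  rw [(Submodule.equivMapOfInjective _ hinj _).finrank_eq]
  refine (Submodule.finrank_mono ?_).trans (φ n).2.le
  rw [Submodule.map_span_le]
  rintro _ ⟨l, rfl⟩
  fin_cases l
  · exact hall i (Submodule.mem_span_singleton_self _)
  · exact hall j hji
  · exact hall k hki

end DoubleReflection

theorem mainTheorem6 {K : Type*} [Field K] (hK : (2 : K) ≠ 0) {d m : ℕ} (hd : 2 ≤ d)
    (F : DoubleReflection.ConfocalFamily K d)
    (φ : (Fin m → ℤ) → DoubleReflection.Line K d)
    (hφ : DoubleReflection.IsDoubleReflectionNet F φ)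
    (n₀ : Fin m → ℤ) (i j k : Fin m) (hij : i ≠ j) (hik : i ≠ k) (hjk : j ≠ k) :
    ∃ Fi Fij Fik Fijk : ℙ K (Fin (d + 1) → K),
      DoubleReflection.IsFocalPoint φ i n₀ Fi ∧
      DoubleReflection.IsFocalPoint φ i (n₀ + DoubleReflection.e j) Fij ∧
      DoubleReflection.IsFocalPoint φ i (n₀ + DoubleReflection.e k) Fik ∧
      DoubleReflection.IsFocalPoint φ i
        (n₀ + DoubleReflection.e j + DoubleReflection.e k) Fijk ∧
      DoubleReflection.Coplanar Fi Fij Fik Fijk := by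
  obtain ⟨-, Q, hQ, hT, hC⟩ := hφ
  have hR : ∀ j n, ∃ x u, DoubleReflection.ReflectionLaw F (Q j) (φ n)
      (φ (n + DoubleReflection.e j)) x u := by
    intro j n
    obtain ⟨x, u, h, -⟩ := hT j n
    exact ⟨x 0, u 0, by simpa using h 0⟩
  choose X U hR using hR
  -- The trajectories and the configurations supply separate witnesses; their tangent covectors
  -- agree up to scale because the reflection point is the intersection of the two lines.
  have hU : ∀ j n x u, DoubleReflection.ReflectionLaw F (Q j) (φ n)
      (φ (n + DoubleReflection.e j)) x u → U j n ∈ Submodule.span K {u} := by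
    intro j n x u h
    refine h.1.mem_span (hQ j).2 (hR j n).1 ?_
    rw [← h.inf_eq]
    exact ⟨(hR j n).2.1, (hR j n).2.2.1⟩
  have hP : ∀ i j, i ≠ j → ∀ n, ∃ S : Submodule K (Fin (d + 1) → K), Module.finrank K S ≤ 2 ∧
      U i n ∈ S ∧ U i (n + DoubleReflection.e j) ∈ S ∧ U j n ∈ S ∧
      U j (n + DoubleReflection.e i) ∈ S := by
    intro i j hij n
    obtain ⟨x₁, x₂, y₁, y₂, α₁, α₂, β₁, β₂, h1, h2, h3, h4, hS⟩ := hC i j hij n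
    rw [add_right_comm] at h2
    refine ⟨_, hS, ?_, ?_, ?_, ?_⟩
    · exact Submodule.span_mono (by simp) (hU _ _ _ _ h1)
    · exact Submodule.span_mono (by simp) (hU _ _ _ _ h2)
    · exact Submodule.span_mono (by simp) (hU _ _ _ _ h3)
    · exact Submodule.span_mono (by simp) (hU _ _ _ _ h4)
  have hfocal : ∀ n, DoubleReflection.IsFocalPoint φ i n
      (Projectivization.mk K (X i n) (hR i n).1.1) := fun n => by
    rw [DoubleReflection.IsFocalPoint, Projectivization.submodule_mk, (hR i n).inf_eq]
  obtain ⟨T, hT3, m0, m1, m2, m3⟩ :=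
    DoubleReflection.exists_finrank_le_three hK hd hQ hR hP n₀ hij hik hjk
  exact ⟨_, _, _, _, hfocal _, hfocal _, hfocal _, hfocal _,
    DoubleReflection.exists_mk_coplanar _ _ _ _ hT3 m0 m1 m2 m3⟩
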